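/- Let $X, X_1, X_2, \ldots$ be i.i.d. real random variables, let $S_n := \sum_{i=1}^n X_i$ and let $G_n := \frac1n \sum_{i=1}^n S_i$ ($n \ge 1$). Suppose that $\mathbb{P}(X \in b + h\mathbb{Z}) = 1$, where $b \in \mathbb{R}$ and $h > 0$ is maximal (that is, if $h' > 0$, $b' \in \mathbb{R}$ and $\mathbb{P}(X \in b' + h'\mathbb{Z}) = 1$, then $h' \le h$). Suppose also that $X$ and $-X$ have the same distribution, and that $X$ is in the domain of normal attraction of a (non-degenerate) symmetric $\alpha$-stable distribution $\nu$ with $\alpha \in (0,1)$, i.e., there are $a > 0$ and constants $A_n \in \mathbb{R}$ such that $\frac{S_n}{a n^{1/\alpha}} - A_n$ converges in distribution to $Z \sim \nu$ as $n \to \infty$. Then the stable law of $aZ$ has a continuous density $g$ on $\mathbb{R}$ (so that $g$ is the density of $\nu$ itself if $\nu$ is normalised so that $a = 1$), and $$\lim_{n \to \infty} \sup_{x \in \mathcal{L}_n} \left| \frac{n^{1+1/\alpha}}{h}\, \mathbb{P}\bigl(G_n = n^{1/\alpha} x\bigr) - (\alpha+1)^{1/\alpha}\, g\bigl((\alpha+1)^{1/\alpha}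 x\bigr) \right| = 0,$$ where $\mathcal{L}_n := \bigl\{ n^{-1-1/\alpha} \bigl( \tfrac12 n(n+1) b + h k \bigr) : k \in \mathbb{Z} \bigr\}$. -/

import Mathlib

open MeasureTheory ProbabilityTheory Filter Topology

noncomputable section

namespace CentreOfMass

/-- The random walk `S_n = X_1 + ... + X_n`; the increment `X_{i+1}` is `X i`. -/
def walk {Ω : Type*} (X : ℕ → Ω → ℝ) (n : ℕ) (ω : Ω) : ℝ :=
  ∑ i ∈ Finset.range n, X i ω

/-- The centre of mass `G_n = (1/n) * (S_1 + ... + S_n)`, with `G_0 = 0`. -/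
def centre {Ω : Type*} (X : ℕ → Ω → ℝ) (n : ℕ) (ω : Ω) : ℝ :=
  (∑ i ∈ Finset.Icc 1 n, walk X i ω) / n

/-- `Y` is a.s. in `b + hℤ`, with `h > 0` maximal: no `b' + h'ℤ` with `h' > h` carries `Y`. -/
structure HasMaximalSpan {Ω : Type*} [MeasurableSpace Ω] (P : Measure Ω) (Y : Ω → ℝ)
    (b h : ℝ) : Prop where
  pos : 0 < h
  mem_lattice : ∀ᵐ ω ∂P, ∃ k : ℤ, Y ω = b + h * k
  maximal : ∀ b' h' : ℝ, 0 < h' → (∀ᵐ ω ∂P, ∃ k : ℤ, Y ω = b' + h' * k) → h' ≤ h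

/-- `ν` is a (non-degenerate) symmetric `α`-stable law on `ℝ`: for `Z₁, Z₂, Z` with law `ν`, where
`Z₁, Z₂` are independent, and all `A, B > 0`, the variable `A Z₁ + B Z₂` has the same law as
`(A ^ α + B ^ α) ^ (1 / α) Z + D` for some constant `D`; moreover `Z` and `-Z` have the same
law, and `Z` is not a.s. constant. -/
structure IsSymmetricStable (α : ℝ) (ν : Measure ℝ) : Prop where
  stable : ∀ A B : ℝ, 0 < A → 0 < B → ∃ D : ℝ,
    (ν.map (fun z => A * z)) ∗ (ν.map (fun z => B * z)) =
      ν.map (fun z => (A ^ α + B ^ α) ^ (1 / α) * z + D)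
  symm : ν.map (fun z => -z) = ν
  nondegenerate : ∀ x : ℝ, ν ≠ Measure.dirac x

/-- The increments `X` are in the domain of normal attraction of `ν`, with index `α` and scale
`a`: for some centring constants `A_n`, the variables `S_n / (a n ^ (1 / α)) - A_n` converge
in distribution to `ν`. -/
def NormallyAttracted {Ω : Type*} [MeasurableSpace Ω] (P : Measure Ω) [IsProbabilityMeasure P]
    (X : ℕ → Ω → ℝ) (α a : ℝ) (ν : Measure ℝ) [IsProbabilityMeasure ν] : Prop :=
  ∃ A : ℕ → ℝ, TendstoInDistribution
    (fun (n : ℕ) ω => walk X n ω / (a * (n : ℝ) ^ (1 / α)) - A n) atTop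
    (id : ℝ → ℝ) (fun _ => P) ν

/-- The lattice `n ^ (-1 - 1 / α) * (n (n + 1) / 2 * b + hℤ)`. -/
def lattice (α b h : ℝ) (n : ℕ) : Set ℝ :=
  {x | ∃ k : ℤ, x = (n : ℝ) ^ (-1 - 1 / α) * ((n : ℝ) * (n + 1) / 2 * b + h * k)}

/-- `p_n(x) = P(G_n = n ^ (1 / α) x)`. -/
def pointProb {Ω : Type*} [MeasurableSpace Ω] (P : Measure Ω) (X : ℕ → Ω → ℝ) (α : ℝ)
    (n : ℕ) (x : ℝ) : ℝ :=
  P.real {ω | centre X n ω = (n : ℝ) ^ (1 / α) * x}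

end CentreOfMass

end

/-! The variable `n G_n` is a sum of the independent increments with weights `n, ..., 1`, so its
characteristic function at `t` is `∏ φ(j t)`, `1 ≤ j ≤ n`, where `φ` is that of `X`. With `N = n ^
(1 + 1/α)`, lattice inversion writes the rescaled point probability as the inverse transform of `s ↦
∏ φ(j s / N)` cut off at `|s| ≤ π N / h` (`mul_pointProb_eq`). The limit in the theorem is the
inverse transform of `exp (-C |s|^α / (α + 1))`. Inverse transforms differ, uniformly in `x`, by at
most a constant times the `L¹` distance, so `L¹` convergence suffices; it comes from dominated
convergence (`tendsto_integral_norm_rescaledProd_sub`).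

Pointwise convergence: normal attraction forces `log |φ(t)| ~ -C |t|^α` at `0`, symmetry makes `φ`
real, and `∑ j^α ~ n^(α+1) / (α + 1)`.

Domination: for `|s| ≤ δ n^(1/α)` every argument `j s / N` is small and the same asymptotics bound
the product. For larger `s` the points `j t`, `t = s / N`, may run through many periods of `|φ|`,
and single factors may equal `1`. But `|φ(u)|` and `|φ(u + w)|` cannot both be near `1` when `|φ(w)|
< 1`; pairing `j` with `j + m`, for `m t` in a fixed compact set, gives exponential decay in `n`
(`exists_prod_norm_charFun_le`). -/

namespace CentreOfMass

open scoped Real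

/-! ### Fourier inversion for probability measures with integrable characteristic function. -/

section FourierInversion

open scoped FourierTransform SchwartzMap ContDiff

/-- The function recovered from `f` by the inversion formula for characteristic functions. -/
noncomputable def inverseCharFun (f : ℝ → ℂ) (x : ℝ) : ℂ :=
  (2 * π)⁻¹ * ∫ t : ℝ, Complex.exp (-(t * x * Complex.I)) * f t

lemma inverseCharFun_eq_fourier (f : ℝ → ℂ) :
    inverseCharFun f = 𝓕 (fun w : ℝ => f (2 * π * w)) := by
  ext x
  rw [Real.fourier_real_eq_integral_exp_smul, inverseCharFun]
  have h := Measure.integral_comp_mul_left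
    (fun t : ℝ => Complex.exp (-(t * x * Complex.I)) * f t) (2 * π)
  rw [abs_of_pos (by positivity)] at h
  have h' : ∀ g : ℂ, (2 * π : ℝ)⁻¹ • g = ((2 * π : ℂ))⁻¹ * g := by
    intro g; rw [Complex.real_smul]; push_cast; rfl
  rw [h'] at h
  push_cast
  rw [← h]
  congr 1 with t
  rw [smul_eq_mul]
  congr 2
  push_cast
  ring

lemma continuous_inverseCharFun {f : ℝ → ℂ} (hf : Integrable f) :
    Continuous (inverseCharFun f) := by
  rw [inverseCharFun_eq_fourier]
  exact VectorFourier.fourierIntegral_continuous Real.continuous_fourierChar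
    (by exact continuous_inner) (hf.comp_mul_left' (by positivity))

lemma conj_inverseCharFun_charFun (μ : Measure ℝ) (x : ℝ) :
    (starRingEnd ℂ) (inverseCharFun (charFun μ) x) = inverseCharFun (charFun μ) x := by
  rw [inverseCharFun, map_mul, ← integral_conj]
  congr 1
  · exact Complex.conj_ofReal _
  · rw [← integral_neg_eq_self]
    congr 1 with t
    rw [map_mul, charFun_neg, Complex.conj_conj, ← Complex.exp_conj]
    congr 2
    simp

/-- Fubini, used twice: once between Lebesgue measure and itself, to move the transform onto `γ`,
and once between `μ` and Lebesgue measure, to undo it. -/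
lemma integral_inverseCharFun_mul {μ : Measure ℝ} [IsProbabilityMeasure μ]
    (hμ : Integrable (charFun μ)) (γ : 𝓢(ℝ, ℂ)) :
    ∫ x, inverseCharFun (charFun μ) x * γ x = ∫ x, γ x ∂μ := by
  rw [inverseCharFun_eq_fourier]
  set F : ℝ → ℂ := fun w => charFun μ (2 * π * w) with hF
  have hFi : Integrable F := hμ.comp_mul_left' (by positivity)
  have h1 := VectorFourier.integral_fourierIntegral_smul_eq_flip (L := innerₗ ℝ) (μ := volume)
    (ν := volume) Real.continuous_fourierChar (by exact continuous_inner) hFi γ.integrable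
  have h2 := VectorFourier.integral_fourierIntegral_smul_eq_flip (L := -innerₗ ℝ) (μ := μ)
    (ν := volume) (f := fun _ => (1 : ℂ)) (g := (𝓕 γ : 𝓢(ℝ, ℂ)))
    Real.continuous_fourierChar
    (by exact (continuous_inner (𝕜 := ℝ) (E := ℝ)).neg) (integrable_const _)
    (𝓕 γ : 𝓢(ℝ, ℂ)).integrable
  have hF' : F = VectorFourier.fourierIntegral 𝐞 μ (-innerₗ ℝ) (fun _ => (1 : ℂ)) := by
    ext w
    rw [hF]
    simp only [charFun_apply_real, VectorFourier.fourierIntegral, LinearMap.neg_apply, neg_neg,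
      innerₗ_apply_apply, Circle.smul_def, Real.fourierChar_apply, smul_eq_mul, mul_one]
    congr 1 with x
    simp
    ring_nf
  have h3 : ∀ w, VectorFourier.fourierIntegral 𝐞 volume (innerₗ ℝ).flip (γ : ℝ → ℂ) w
      = (𝓕 γ : 𝓢(ℝ, ℂ)) w := by
    intro w
    rw [SchwartzMap.fourier_coe, Real.fourier_eq]
    simp [VectorFourier.fourierIntegral]
  have h4 : ∀ x, VectorFourier.fourierIntegral 𝐞 volume (-innerₗ ℝ).flip
      ((𝓕 γ : 𝓢(ℝ, ℂ)) : ℝ → ℂ) x = γ x := by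
    intro x
    have : (𝓕⁻ (𝓕 γ) : 𝓢(ℝ, ℂ)) x = γ x := by simp
    rw [← this, SchwartzMap.fourierInv_coe, Real.fourierInv_eq]
    simp [VectorFourier.fourierIntegral, mul_comm]
  simp_rw [h3] at h1
  simp_rw [h4, ← hF'] at h2
  simp only [smul_eq_mul, one_mul] at h1 h2
  rw [← h2, ← h1]
  rfl

lemma ofReal_re_inverseCharFun {μ : Measure ℝ} (x : ℝ) :
    (((inverseCharFun (charFun μ) x).re : ℝ) : ℂ) = inverseCharFun (charFun μ) x :=
  Complex.conj_eq_iff_re.mp (conj_inverseCharFun_charFun μ x)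

lemma integral_re_inverseCharFun_mul {μ : Measure ℝ} [IsProbabilityMeasure μ]
    (hμ : Integrable (charFun μ)) {χ : ℝ → ℝ} (hχ : ContDiff ℝ ∞ χ) (hc : HasCompactSupport χ) :
    ∫ x, (inverseCharFun (charFun μ) x).re * χ x = ∫ x, χ x ∂μ := by
  have hc' : HasCompactSupport (fun x => (χ x : ℂ)) := hc.comp_left (g := ((↑) : ℝ → ℂ)) (by simp)
  have hχ' : ContDiff ℝ ∞ (fun x => (χ x : ℂ)) := Complex.ofRealCLM.contDiff.comp hχ
  have h := integral_inverseCharFun_mul hμ (hc'.toSchwartzMap hχ')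
  change ∫ x, inverseCharFun (charFun μ) x * (χ x : ℂ) = ∫ x, (χ x : ℂ) ∂μ at h
  have h' : ∀ x, inverseCharFun (charFun μ) x * (χ x : ℂ)
      = (((inverseCharFun (charFun μ) x).re * χ x : ℝ) : ℂ) := by
    intro x; rw [Complex.ofReal_mul, ofReal_re_inverseCharFun]
  simp_rw [h'] at h
  rw [integral_complex_ofReal, integral_complex_ofReal] at h
  exact_mod_cast h

/-- A bump supported where the continuous candidate density is negative would have a negative
integral against `μ`. -/
lemma inverseCharFun_re_nonneg {μ : Measure ℝ} [IsProbabilityMeasure μ]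
    (hμ : Integrable (charFun μ)) (y : ℝ) : 0 ≤ (inverseCharFun (charFun μ) y).re := by
  by_contra! hy
  have hcont : Continuous fun x => (inverseCharFun (charFun μ) x).re :=
    Complex.continuous_re.comp (continuous_inverseCharFun hμ)
  obtain ⟨r, hr, hball⟩ := Metric.eventually_nhds_iff_ball.mp
    (hcont.continuousAt.eventually_lt_const hy)
  let χ : ContDiffBump y := ⟨r / 2, r, by positivity, by linarith⟩
  have h := integral_re_inverseCharFun_mul hμ (χ := χ) χ.contDiff χ.hasCompactSupport
  have h1 : 0 ≤ ∫ x, χ x ∂μ := integral_nonneg fun x => χ.nonneg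
  have h2 : 0 < ∫ x, -((inverseCharFun (charFun μ) x).re * χ x) := by
    refine Continuous.integral_pos_of_hasCompactSupport_nonneg_nonzero (x := y) ?_ ?_ ?_ ?_
    · exact (hcont.mul χ.continuous).neg
    · exact (χ.hasCompactSupport.mul_left).neg
    · intro x
      by_cases hx : x ∈ Metric.ball y r
      · have := hball x hx
        have := χ.nonneg (x := x)
        simp only [Pi.zero_apply]
        nlinarith
      · have : χ x = 0 := χ.zero_of_le_dist (by simpa [Metric.mem_ball] using hx)
        simp [this]
    · have : χ y = 1 := χ.one_of_mem_closedBall (Metric.mem_closedBall_self (by positivity))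
      simp [this, hy.ne]
  rw [integral_neg, h] at h2
  linarith

/-- The candidate density is nonnegative, and bumps equal to `1` on growing balls bound its integral
there by the total mass `1`. -/
lemma integrable_inverseCharFun {μ : Measure ℝ} [IsProbabilityMeasure μ]
    (hμ : Integrable (charFun μ)) : Integrable (inverseCharFun (charFun μ)) := by
  have hcont : Continuous fun x => (inverseCharFun (charFun μ) x).re :=
    Complex.continuous_re.comp (continuous_inverseCharFun hμ)
  have key : Integrable fun x => (inverseCharFun (charFun μ) x).re := by
    refine (aecover_closedBall (x := (0 : ℝ)) (r := fun n : ℕ => (n : ℝ) + 1) (l := atTop)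
      (tendsto_atTop_add_const_right _ _ tendsto_natCast_atTop_atTop)
      ).integrable_of_integral_bounded_of_nonneg_ae 1
      (fun n => hcont.continuousOn.integrableOn_compact (isCompact_closedBall _ _))
      (ae_of_all _ (inverseCharFun_re_nonneg hμ)) (Eventually.of_forall fun n => ?_)
    let χ : ContDiffBump (0 : ℝ) := ⟨(n : ℝ) + 1, n + 2, by positivity, by linarith⟩
    have hint : Integrable fun x => (inverseCharFun (charFun μ) x).re * χ x :=
      (hcont.mul χ.continuous).integrable_of_hasCompactSupport χ.hasCompactSupport.mul_left
    calc ∫ x in Metric.closedBall 0 ((n : ℝ) + 1), (inverseCharFun (charFun μ) x).re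
        = ∫ x in Metric.closedBall 0 ((n : ℝ) + 1), (inverseCharFun (charFun μ) x).re * χ x := by
          refine setIntegral_congr_fun Metric.isClosed_closedBall.measurableSet fun x hx => ?_
          simp only [χ.one_of_mem_closedBall hx, mul_one]
      _ ≤ ∫ x, (inverseCharFun (charFun μ) x).re * χ x :=
          setIntegral_le_integral hint
            (ae_of_all _ fun x => mul_nonneg (inverseCharFun_re_nonneg hμ x) χ.nonneg)
      _ = ∫ x, χ x ∂μ := integral_re_inverseCharFun_mul hμ χ.contDiff χ.hasCompactSupport
      _ ≤ ∫ x, (1 : ℝ) ∂μ := by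
          refine integral_mono_of_nonneg (ae_of_all _ fun x => χ.nonneg) (integrable_const _)
            (ae_of_all _ fun x => χ.le_one)
      _ = 1 := by simp
  have := key.ofReal (𝕜 := ℂ)
  refine this.congr (ae_of_all _ fun x => ?_)
  exact ofReal_re_inverseCharFun x

/-- A probability measure on `ℝ` with an integrable characteristic function has a continuous
density, given by the inversion formula. -/
theorem eq_withDensity_of_integrable_charFun {μ : Measure ℝ} [IsProbabilityMeasure μ]
    (hμ : Integrable (charFun μ)) :
    μ = volume.withDensity fun x => ENNReal.ofReal (inverseCharFun (charFun μ) x).re := by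
  have hcont : Continuous fun x => (inverseCharFun (charFun μ) x).re :=
    Complex.continuous_re.comp (continuous_inverseCharFun hμ)
  have hint : Integrable fun x => (inverseCharFun (charFun μ) x).re :=
    (integrable_inverseCharFun hμ).re
  have : IsFiniteMeasure (volume.withDensity fun x =>
      ENNReal.ofReal (inverseCharFun (charFun μ) x).re) :=
    isFiniteMeasure_withDensity_ofReal hint.2
  refine Measure.ext_of_charFun ?_
  ext t
  set F : ℝ → ℂ := fun w => charFun μ (2 * π * w) with hF
  have hFc : Continuous F := by
    have := continuous_charFun (μ := μ)
    fun_prop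
  -- With the candidate density integrable, classical inversion recovers `charFun μ` as its
  -- transform, so the two measures share a characteristic function.
  have hinv := congrFun (hFc.fourierInv_fourier_eq (hμ.comp_mul_left' (by positivity)) (by
    rw [← inverseCharFun_eq_fourier]; exact integrable_inverseCharFun hμ)) (t / (2 * π))
  rw [← inverseCharFun_eq_fourier, Real.fourierInv_eq', hF] at hinv
  simp only [mul_div_cancel₀ t (show (2 * π) ≠ 0 by positivity)] at hinv
  rw [← hinv, charFun_apply_real, integral_withDensity_eq_integral_toReal_smul hcont.measurable.ennreal_ofReal
    (by simp)]
  congr 1 with x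
  rw [ENNReal.toReal_ofReal (inverseCharFun_re_nonneg hμ x), Complex.real_smul,
    ofReal_re_inverseCharFun, mul_comm (inverseCharFun _ _), smul_eq_mul]
  congr 3
  simp only [RCLike.inner_apply, conj_trivial]
  push_cast
  field_simp

end FourierInversion

/-! ### Characteristic functions of symmetric stable laws. -/

/-- A nonnegative continuous function, multiplicative on `[0, ∞)`, is an exponential. -/
lemma exists_eq_exp_of_multiplicative {f : ℝ → ℝ} (hf : Continuous f) (hnn : ∀ u, 0 ≤ f u)
    (h0 : f 0 = 1) (hmul : ∀ u v, 0 ≤ u → 0 ≤ v → f (u + v) = f u * f v) :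
    ∃ c : ℝ, ∀ u, 0 ≤ u → f u = Real.exp (-(c * u)) := by
  have hpos : ∀ u, 0 ≤ u → 0 < f u := by
    intro u hu
    refine lt_of_le_of_ne (hnn u) fun hz => ?_
    -- A zero at `u` propagates to `u / 2 ^ n` since `f (2 v) = f v ^ 2`, and continuity then
    -- contradicts `f 0 = 1`.
    have hz' : ∀ n : ℕ, f (u * (1 / 2) ^ n) = 0 := by
      intro n
      induction n with
      | zero => simpa using hz.symm
      | succ n ih =>
        have := hmul (u * (1 / 2) ^ (n + 1)) (u * (1 / 2) ^ (n + 1)) (by positivity)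
          (by positivity)
        rw [show u * (1 / 2 : ℝ) ^ (n + 1) + u * (1 / 2) ^ (n + 1) = u * (1 / 2) ^ n by ring,
          ih] at this
        exact mul_self_eq_zero.mp this.symm
    have hlim : Tendsto (fun n : ℕ => f (u * (1 / 2) ^ n)) atTop (𝓝 (f (u * 0))) :=
      (hf.tendsto _).comp ((tendsto_pow_atTop_nhds_zero_of_lt_one (by norm_num)
        (by norm_num)).const_mul u)
    simp only [hz', mul_zero, h0] at hlim
    exact zero_ne_one (tendsto_nhds_unique tendsto_const_nhds hlim)
  have hlog : ∀ u v, 0 ≤ u → 0 ≤ v → Real.log (f (u + v)) = Real.log (f u) + Real.log (f v) :=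
    fun u v hu hv => by rw [hmul u v hu hv, Real.log_mul (hpos u hu).ne' (hpos v hv).ne']
  -- The odd extension of `log ∘ f` is additive on all of `ℝ`, hence linear by continuity.
  -- Additivity is checked with all negative parts moved across, so that only sums of nonnegative
  -- terms occur.
  let L : ℝ →+ ℝ :=
    { toFun := fun x => Real.log (f (max x 0)) - Real.log (f (max (-x) 0))
      map_zero' := by simp
      map_add' := by
        intro x y
        have hx := max_zero_sub_max_neg_zero_eq_self x
        have hy := max_zero_sub_max_neg_zero_eq_self y
        have hxy := max_zero_sub_max_neg_zero_eq_self (x + y)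
        have e : max (x + y) 0 + (max (-x) 0 + max (-y) 0)
            = max (-(x + y)) 0 + (max x 0 + max y 0) := by linarith
        have h := congrArg (fun z => Real.log (f z)) e
        beta_reduce at h
        rw [hlog _ _ (by positivity) (by positivity), hlog _ _ (by positivity) (by positivity),
          hlog _ _ (by positivity) (by positivity), hlog _ _ (by positivity) (by positivity)] at h
        linarith }
  have hL : Continuous L := by
    change Continuous fun x => Real.log (f (max x 0)) - Real.log (f (max (-x) 0))
    have h1 : Continuous fun x : ℝ => Real.log (f (max x 0)) :=
      (hf.comp (by fun_prop)).log fun x => (hpos _ (by positivity)).ne'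
    exact h1.sub (h1.comp continuous_neg)
  refine ⟨-L 1, fun u hu => ?_⟩
  have h1 : L u = u * L 1 := by
    have := map_real_smul L hL u 1
    simpa using this
  have h2 : L u = Real.log (f u) := by
    change Real.log (f (max u 0)) - Real.log (f (max (-u) 0)) = _
    rw [max_eq_left hu, max_eq_right (by linarith), h0]
    simp
  rw [← Real.exp_log (hpos u hu), ← h2, h1]
  ring_nf

lemma ofReal_re_charFun_of_symm {μ : Measure ℝ} (hμ : μ.map (fun z => -z) = μ) (t : ℝ) :
    ((charFun μ t).re : ℂ) = charFun μ t := by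
  rw [← Complex.conj_eq_iff_re, ← charFun_neg]
  conv_rhs => rw [← hμ]
  have := charFun_map_mul (μ := μ) (-1) t
  simpa using this.symm

lemma IsSymmetricStable.exists_charFun_eq {α : ℝ} (hα : 0 < α) {ν : Measure ℝ}
    [IsProbabilityMeasure ν] (hν : IsSymmetricStable α ν) :
    ∃ c : ℝ, 0 < c ∧ ∀ t, charFun ν t = (Real.exp (-(c * |t| ^ α)) : ℝ) := by
  have hcont : Continuous (charFun ν) := continuous_charFun
  have hzero : charFun ν 0 = 1 := by simp
  -- Norms remove the shift `D`, and the substitution `u = t ^ α` turns stability into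
  -- multiplicativity.
  obtain ⟨c, hc⟩ := exists_eq_exp_of_multiplicative (f := fun u => ‖charFun ν (|u| ^ (1 / α))‖)
    (by
      refine (hcont.comp ?_).norm
      exact continuous_abs.rpow_const fun x => Or.inr (by positivity))
    (fun u => norm_nonneg _) (by
      simp [hα.ne']) (by
      intro u v hu hv
      rcases hu.eq_or_lt with rfl | hu
      · simp [hα.ne']
      rcases hv.eq_or_lt with rfl | hv
      · simp [hα.ne']
      obtain ⟨D, hD⟩ := hν.stable (u ^ (1 / α)) (v ^ (1 / α)) (by positivity) (by positivity)
      have h := congrArg (fun μ : Measure ℝ => ‖charFun μ 1‖) hD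
      beta_reduce at h
      have : IsProbabilityMeasure (ν.map fun z => u ^ (1 / α) * z) :=
        Measure.isProbabilityMeasure_map (by fun_prop)
      have : IsProbabilityMeasure (ν.map fun z => v ^ (1 / α) * z) :=
        Measure.isProbabilityMeasure_map (by fun_prop)
      rw [charFun_conv, charFun_map_mul, charFun_map_mul] at h
      have h2 : ν.map (fun z => ((u ^ (1 / α)) ^ α + (v ^ (1 / α)) ^ α) ^ (1 / α) * z + D)
          = (ν.map (fun z => ((u ^ (1 / α)) ^ α + (v ^ (1 / α)) ^ α) ^ (1 / α) * z)).map
            (· + D) := by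
        rw [Measure.map_map (by fun_prop) (by fun_prop)]
        rfl
      rw [h2, charFun_map_add_const, charFun_map_mul, norm_mul, norm_mul,
        Complex.norm_exp_ofReal_mul_I, mul_one, mul_one, mul_one, mul_one,
        ← Real.rpow_mul hu.le, ← Real.rpow_mul hv.le, one_div_mul_cancel hα.ne', Real.rpow_one,
        Real.rpow_one] at h
      rw [abs_of_pos hu, abs_of_pos hv, abs_of_pos (add_pos hu hv), h])
  have hnorm : ∀ t, ‖charFun ν t‖ = Real.exp (-(c * |t| ^ α)) := by
    intro t
    have h := hc (|t| ^ α) (by positivity)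
    rw [abs_of_nonneg (show (0 : ℝ) ≤ |t| ^ α by positivity), ← Real.rpow_mul (abs_nonneg t),
      mul_one_div_cancel hα.ne', Real.rpow_one] at h
    rw [← h]
    rcases abs_choice t with ht | ht
    · rw [ht]
    · rw [ht, charFun_neg, RCLike.norm_conj]
  have hre : ∀ t, ‖charFun ν t‖ = |(charFun ν t).re| := by
    intro t
    rw [← ofReal_re_charFun_of_symm hν.symm, Complex.norm_real, Real.norm_eq_abs,
      Complex.ofReal_re]
  -- The characteristic function is real, equals `1` at `0`, and has nowhere vanishing norm, so it
  -- cannot change sign.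
  have hpos : ∀ t, 0 < (charFun ν t).re := by
    intro t
    by_contra! hneg
    have hrc : Continuous fun s => (charFun ν s).re := Complex.continuous_re.comp hcont
    obtain ⟨s, hs⟩ : ∃ s, (charFun ν s).re = 0 :=
      mem_range_of_exists_le_of_exists_ge hrc ⟨t, hneg⟩ ⟨0, by simp [hzero]⟩
    have h1 := hnorm s
    rw [hre, hs, abs_zero] at h1
    exact (Real.exp_pos _).ne h1
  have heq : ∀ t, charFun ν t = (Real.exp (-(c * |t| ^ α)) : ℝ) := by
    intro t
    rw [← hnorm, hre, abs_of_pos (hpos t), ofReal_re_charFun_of_symm hν.symm]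
  refine ⟨c, lt_of_le_of_ne ?_ ?_, heq⟩
  · have h1 := norm_charFun_le_one (μ := ν) (t := 1)
    rw [hnorm, Real.exp_le_one_iff] at h1
    simpa using h1
  · rintro rfl
    refine hν.nondegenerate 0 (Measure.ext_of_charFun ?_)
    ext t
    rw [heq, charFun_dirac]
    simp

/-! ### The characteristic function of the increments near the origin. -/

section Increments

variable {Ω : Type*} [MeasurableSpace Ω] {P : Measure Ω}
  {X : ℕ → Ω → ℝ}

lemma charFun_map_weighted_sum (hX : ∀ i, Measurable (X i)) (hindep : iIndepFun X P)
    (hident : ∀ i, IdentDistrib (X i) (X 0) P P) (w : ℕ → ℝ) (s : Finset ℕ) (t : ℝ) :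
    charFun (P.map fun ω => ∑ i ∈ s, w i * X i ω) t
      = ∏ i ∈ s, charFun (P.map (X 0)) (w i * t) := by
  have h := iIndepFun.charFun_map_fun_finsetSum_eq_prod (s := s) (P := P)
    (X := fun i ω => w i * X i ω) (fun i _ => ((hX i).const_mul (w i)).aemeasurable)
    ((hindep.comp (fun i x => w i * x) fun i => measurable_const_mul (w i)).restrict s)
  rw [h, Finset.prod_apply]
  refine Finset.prod_congr rfl fun i _ => ?_
  rw [charFun_map_mul_comp (hX i).aemeasurable, (hident i).map_eq]

lemma charFun_map_walk (hX : ∀ i, Measurable (X i)) (hindep : iIndepFun X P)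
    (hident : ∀ i, IdentDistrib (X i) (X 0) P P) (n : ℕ) (t : ℝ) :
    charFun (P.map (walk X n)) t = charFun (P.map (X 0)) t ^ n := by
  have h := charFun_map_weighted_sum hX hindep hident (fun _ => 1) (Finset.range n) t
  simp only [one_mul, Finset.prod_const, Finset.card_range] at h
  exact h

lemma measurable_walk (hX : ∀ i, Measurable (X i)) (n : ℕ) : Measurable (walk X n) := by
  unfold walk
  fun_prop

lemma tendstoInMeasure_const_of_tendsto {ι : Type*} {l : Filter ι} {u : ι → ℝ} {c : ℝ}
    (hu : Tendsto u l (𝓝 c)) : TendstoInMeasure P (fun i _ => u i) l (fun _ => c) := by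
  intro ε hε
  refine tendsto_const_nhds.congr' ?_
  filter_upwards [EMetric.tendsto_nhds.mp hu ε hε] with i hi
  simp [not_le.mpr hi]

lemma tendsto_mul_rpow_neg_nhdsGT_zero {α a : ℝ} (hα : 0 < α) (ha : 0 < a) :
    Tendsto (fun s : ℝ => (a * s) ^ (-α)) (𝓝[>] 0) atTop := by
  have h : Tendsto (fun s : ℝ => a * s) (𝓝[>] 0) (𝓝[>] 0) := by
    refine tendsto_nhdsWithin_iff.mpr ⟨?_, ?_⟩
    · have : Tendsto (fun s : ℝ => a * s) (𝓝 0) (𝓝 (a * 0)) := tendsto_id.const_mul a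
      rw [mul_zero] at this
      exact this.mono_left nhdsWithin_le_nhds
    · filter_upwards [self_mem_nhdsWithin] with s hs
      exact mul_pos ha hs
  exact (tendsto_rpow_neg_nhdsGT_zero (neg_lt_zero.mpr hα)).comp h

/-- Normal attraction to a law with characteristic function `exp (-c |t| ^ α)` determines the
logarithm of the characteristic function of the increments at the origin. -/
lemma tendsto_log_charFun_div_rpow [IsProbabilityMeasure P] (hX : ∀ i, Measurable (X i)) (hindep : iIndepFun X P)
    (hident : ∀ i, IdentDistrib (X i) (X 0) P P) {α : ℝ} (hα : 0 < α) {ν : Measure ℝ}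
    [IsProbabilityMeasure ν] {c : ℝ} (hν : ∀ t, charFun ν t = (Real.exp (-(c * |t| ^ α)) : ℝ))
    {a : ℝ} (ha : 0 < a) (hattr : NormallyAttracted P X α a ν) :
    Tendsto (fun s : ℝ => Real.log ‖charFun (P.map (X 0)) s‖ / s ^ α) (𝓝[>] 0)
      (𝓝 (-(c * a ^ α))) := by
  obtain ⟨A, hA⟩ := hattr
  -- Given small `s`, take `n = ⌊(a s) ^ (-α)⌋`, so that `s` is nearly `1 / (a n ^ (1 / α))`. This
  -- turns a limit along integers into one along real `s`.
  set y : ℝ → ℝ := fun s => (a * s) ^ (-α) with hy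
  have hytop : Tendsto y (𝓝[>] 0) atTop := tendsto_mul_rpow_neg_nhdsGT_zero hα ha
  have hn : Tendsto (fun s => ⌊y s⌋₊) (𝓝[>] 0) atTop := tendsto_nat_floor_atTop.comp hytop
  have hratio : Tendsto (fun s => (⌊y s⌋₊ : ℝ) / y s) (𝓝[>] 0) (𝓝 1) :=
    tendsto_nat_floor_div_atTop.comp hytop
  have hr : Tendsto (fun s => ((⌊y s⌋₊ : ℝ) / y s) ^ (1 / α)) (𝓝[>] 0) (𝓝 1) := by
    have := hratio.rpow_const (p := 1 / α) (Or.inl one_ne_zero)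
    rwa [Real.one_rpow] at this
  have hdist : TendstoInDistribution
      (fun (s : ℝ) ω => walk X ⌊y s⌋₊ ω / (a * (⌊y s⌋₊ : ℝ) ^ (1 / α)) - A ⌊y s⌋₊) (𝓝[>] 0)
      (id : ℝ → ℝ) (fun _ => P) ν :=
    ⟨fun s => hA.forall_aemeasurable _, hA.aemeasurable_limit, hA.tendsto.comp hn⟩
  -- Slutsky: the factor `(n / y s) ^ (1 / α) → 1` makes the coefficient of the walk exactly `s`.
  -- The centring only contributes a phase, which the norm below discards.
  have hslut := hdist.continuous_comp_prodMk_of_tendstoInMeasure_const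
    (g := fun p : ℝ × ℝ => p.2 * p.1) (by fun_prop)
    (Y := fun s _ => ((⌊y s⌋₊ : ℝ) / y s) ^ (1 / α)) (c := 1)
    (tendstoInMeasure_const_of_tendsto hr) (fun s => aemeasurable_const)
  have hchar : Tendsto (fun s => ‖charFun (P.map fun ω => ((⌊y s⌋₊ : ℝ) / y s) ^ (1 / α) *
      (walk X ⌊y s⌋₊ ω / (a * (⌊y s⌋₊ : ℝ) ^ (1 / α)) - A ⌊y s⌋₊)) 1‖) (𝓝[>] 0)
      (𝓝 (Real.exp (-c))) := by
    have h1 := (ProbabilityMeasure.tendsto_iff_forall_integral_rclike_tendsto ℂ).mp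
      hslut.tendsto (BoundedContinuousFunction.innerProbChar (1 : ℝ))
    have h2 := h1.norm
    have h3 : ‖charFun ν 1‖ = Real.exp (-c) := by
      rw [hν, Complex.norm_real, Real.norm_eq_abs, abs_of_pos (Real.exp_pos _)]
      simp
    rw [← h3]
    simp only [charFun_eq_integral_innerProbChar]
    simpa using h2
  have hlog : Tendsto (fun s => (⌊y s⌋₊ : ℝ) * Real.log ‖charFun (P.map (X 0)) s‖) (𝓝[>] 0)
      (𝓝 (-c)) := by
    have h1 := (Real.continuousAt_log (Real.exp_pos (-c)).ne').tendsto.comp hchar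
    rw [Real.log_exp] at h1
    refine h1.congr' ?_
    filter_upwards [self_mem_nhdsWithin, hn.eventually_gt_atTop 0] with s hs hn0
    have hs : 0 < s := hs
    have hn0' : (0 : ℝ) < ⌊y s⌋₊ := by exact_mod_cast hn0
    have e : (fun ω => ((⌊y s⌋₊ : ℝ) / y s) ^ (1 / α) *
        (walk X ⌊y s⌋₊ ω / (a * (⌊y s⌋₊ : ℝ) ^ (1 / α)) - A ⌊y s⌋₊))
        = fun ω => s * walk X ⌊y s⌋₊ ω + (-(((⌊y s⌋₊ : ℝ) / y s) ^ (1 / α) * A ⌊y s⌋₊)) := by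
      have hy1 : y s ^ (1 / α) = (a * s)⁻¹ := by
        rw [hy]
        simp only
        rw [← Real.rpow_mul (by positivity), neg_mul, mul_one_div_cancel hα.ne',
          Real.rpow_neg_one]
      ext ω
      have hp : 0 < (⌊y s⌋₊ : ℝ) ^ (1 / α) := by positivity
      have : ((⌊y s⌋₊ : ℝ) / y s) ^ (1 / α) = (⌊y s⌋₊ : ℝ) ^ (1 / α) * (a * s) := by
        rw [Real.div_rpow hn0'.le (by positivity), hy1, div_inv_eq_mul]
      rw [this]
      field_simp
      ring
    have e2 : P.map (fun ω => s * walk X ⌊y s⌋₊ ω +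
        (-(((⌊y s⌋₊ : ℝ) / y s) ^ (1 / α) * A ⌊y s⌋₊)))
        = (P.map fun ω => s * walk X ⌊y s⌋₊ ω).map
          (· + (-(((⌊y s⌋₊ : ℝ) / y s) ^ (1 / α) * A ⌊y s⌋₊))) := by
      rw [Measure.map_map (by fun_prop) ((measurable_walk hX _).const_mul s)]
      rfl
    simp only [Function.comp_apply]
    rw [e, e2, charFun_map_add_const, norm_mul, RCLike.inner_apply, conj_trivial]
    rw [Complex.norm_exp_ofReal_mul_I, mul_one,
      charFun_map_mul_comp (measurable_walk hX _).aemeasurable, mul_one,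
      charFun_map_walk hX hindep hident, norm_pow, Real.log_pow]
  have hq := (hlog.div hratio one_ne_zero).mul_const (a ^ α)
  rw [div_one, neg_mul] at hq
  refine hq.congr' ?_
  filter_upwards [self_mem_nhdsWithin, hn.eventually_gt_atTop 0] with s hs hn0
  have hs : 0 < s := hs
  have hn0' : (0 : ℝ) < ⌊y s⌋₊ := by exact_mod_cast hn0
  have hys : y s = (a ^ α * s ^ α)⁻¹ := by
    rw [hy]
    simp only
    rw [Real.rpow_neg (by positivity), Real.mul_rpow ha.le hs.le]
  have h1 : 0 < a ^ α := by positivity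
  have h2 : 0 < s ^ α := by positivity
  rw [Pi.div_apply, div_div_eq_mul_div]
  rw [show ∀ L : ℝ, (⌊y s⌋₊ : ℝ) * L * y s / ⌊y s⌋₊ = L * y s from fun L => by field_simp, hys]
  field_simp

end Increments

/-! ### Decay of the product of characteristic functions away from the origin. -/

/-- With `1 - cos z = 2 sin² (z / 2)`, this is the addition formula for the sine followed by `(p +
q)² ≤ 2 p² + 2 q²`. -/
lemma one_sub_cos_sub_le (x y : ℝ) :
    1 - Real.cos (y - x) ≤ 2 * (1 - Real.cos x) + 2 * (1 - Real.cos y) := by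
  have hc : ∀ z, Real.cos z = 1 - 2 * Real.sin (z / 2) ^ 2 := by
    intro z
    have h1 := Real.cos_sq_add_sin_sq (z / 2)
    have h2 := Real.cos_two_mul (z / 2)
    rw [mul_div_cancel₀ z two_ne_zero] at h2
    linarith
  have h1 := Real.cos_sq_add_sin_sq (x / 2)
  have h2 := Real.cos_sq_add_sin_sq (y / 2)
  rw [hc x, hc y, hc (y - x), sub_div, Real.sin_sub]
  set p := Real.sin (y / 2)
  set q := Real.cos (y / 2)
  set r := Real.sin (x / 2)
  set s := Real.cos (x / 2)
  have a1 : p ^ 2 * s ^ 2 ≤ p ^ 2 := by nlinarith [sq_nonneg (p * r)]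
  have a2 : q ^ 2 * r ^ 2 ≤ r ^ 2 := by nlinarith [sq_nonneg (p * r)]
  nlinarith [sq_nonneg (p * s + q * r)]

lemma integrable_cos_mul (κ : Measure ℝ) [IsFiniteMeasure κ] (t θ : ℝ) :
    Integrable (fun x => Real.cos (x * t - θ)) κ :=
  (integrable_const (1 : ℝ)).mono' (by fun_prop) (ae_of_all _ fun x => by
    simpa using Real.abs_cos_le_one _)

lemma re_charFun (κ : Measure ℝ) [IsFiniteMeasure κ] (t : ℝ) :
    (charFun κ t).re = ∫ x, Real.cos (x * t) ∂κ := by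
  rw [charFun_apply_real, ← RCLike.re_eq_complex_re, ← integral_re]
  · congr 1 with x
    rw [RCLike.re_eq_complex_re, ← Complex.ofReal_mul, Complex.exp_ofReal_mul_I_re, mul_comm]
  · refine (integrable_const (1 : ℝ)).mono' (by fun_prop) (ae_of_all _ fun x => ?_)
    rw [← Complex.ofReal_mul, Complex.norm_exp_ofReal_mul_I]

lemma one_sub_re_charFun_le (κ : Measure ℝ) [IsProbabilityMeasure κ] (u w : ℝ) :
    1 - (charFun κ w).re ≤ 2 * (1 - (charFun κ u).re) + 2 * (1 - (charFun κ (u + w)).re) := by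
  have hi : ∀ t, Integrable (fun x => Real.cos (x * t)) κ := fun t => by
    simpa using integrable_cos_mul κ t 0
  have h1 : ∀ t, 1 - (charFun κ t).re = ∫ x, (1 - Real.cos (x * t)) ∂κ := by
    intro t
    rw [integral_sub (integrable_const _) (hi t), re_charFun]
    simp
  rw [h1, h1, h1, ← integral_const_mul, ← integral_const_mul, ← integral_add]
  · refine integral_mono ((integrable_const _).sub (hi _))
      ((((integrable_const _).sub (hi _)).const_mul 2).add
        (((integrable_const _).sub (hi _)).const_mul 2)) fun x => ?_
    have := one_sub_cos_sub_le (x * u) (x * (u + w))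
    rwa [show x * (u + w) - x * u = x * w by ring] at this
  · exact ((integrable_const _).sub (hi _)).const_mul 2
  · exact ((integrable_const _).sub (hi _)).const_mul 2

/-- Symmetrisation: `‖charFun μ‖ ^ 2` is the real characteristic function of the difference of two
independent copies. -/
lemma one_sub_norm_charFun_sq_le (μ : Measure ℝ) [IsProbabilityMeasure μ] (u w : ℝ) :
    1 - ‖charFun μ w‖ ^ 2
      ≤ 2 * (1 - ‖charFun μ u‖ ^ 2) + 2 * (1 - ‖charFun μ (u + w)‖ ^ 2) := by
  have : IsProbabilityMeasure (μ.map fun x => -1 * x) :=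
    Measure.isProbabilityMeasure_map (by fun_prop)
  have h : ∀ t, (charFun (μ ∗ μ.map fun x => -1 * x) t).re = ‖charFun μ t‖ ^ 2 := by
    intro t
    rw [charFun_conv, charFun_map_mul, neg_one_mul, charFun_neg, Complex.mul_conj,
      Complex.ofReal_re, Complex.normSq_eq_norm_sq]
  simpa only [h] using one_sub_re_charFun_le (μ ∗ μ.map fun x => -1 * x) u w

/-- Norm `1` at `w` would put `Y` in a translate of `(2π / w) ℤ`, whose span exceeds `h`. -/
lemma norm_charFun_lt_one_of_maximal_span {Ω : Type*} [MeasurableSpace Ω] {P : Measure Ω}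
    [IsProbabilityMeasure P] {Y : Ω → ℝ} (hY : Measurable Y) {b h : ℝ}
    (hspan : HasMaximalSpan P Y b h) {w : ℝ} (hw0 : 0 < w) (hw : w < 2 * π / h) :
    ‖charFun (P.map Y) w‖ < 1 := by
  have : IsProbabilityMeasure (P.map Y) := Measure.isProbabilityMeasure_map hY.aemeasurable
  refine lt_of_le_of_ne (norm_charFun_le_one _) fun h1 => ?_
  obtain ⟨θ, hθ⟩ := (Complex.norm_eq_one_iff _).mp h1
  have hre : ∫ x, Real.cos (x * w - θ) ∂(P.map Y) = 1 := by
    have e := re_charFun ((P.map Y).map (· + (-θ / w))) w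
    rw [charFun_map_add_const, ← hθ, integral_map (by fun_prop) (by fun_prop),
      RCLike.inner_apply, conj_trivial, ← Complex.exp_add] at e
    have e2 : (θ : ℂ) * Complex.I + ((w * (-θ / w) : ℝ) : ℂ) * Complex.I = 0 := by
      rw [mul_div_cancel₀ _ hw0.ne']
      push_cast
      ring
    rw [e2, Complex.exp_zero, Complex.one_re] at e
    rw [e]
    congr 1 with x
    congr 1
    field_simp
    ring
  have hae : ∀ᵐ x ∂(P.map Y), 1 - Real.cos (x * w - θ) = 0 := by
    have hint := (integrable_const (1 : ℝ)).sub (integrable_cos_mul (P.map Y) w θ)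
    refine (integral_eq_zero_iff_of_nonneg
      (fun x => sub_nonneg.mpr (Real.cos_le_one (x * w - θ))) hint).mp ?_
    change ∫ x, (1 - Real.cos (x * w - θ)) ∂(P.map Y) = 0
    rw [integral_sub (integrable_const _) (integrable_cos_mul _ w θ), hre]
    simp
  have hlat : ∀ᵐ ω ∂P, ∃ k : ℤ, Y ω = θ / w + 2 * π / w * k := by
    filter_upwards [ae_of_ae_map hY.aemeasurable hae] with ω hω
    obtain ⟨k, hk⟩ := (Real.cos_eq_one_iff _).mp (show Real.cos (Y ω * w - θ) = 1 by linarith)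
    refine ⟨k, ?_⟩
    field_simp
    linarith
  have hle := hspan.maximal _ _ (by positivity) hlat
  rw [div_le_iff₀ hw0] at hle
  rw [lt_div_iff₀ hspan.pos] at hw
  linarith

lemma exists_norm_charFun_mul_le {μ : Measure ℝ} [IsProbabilityMeasure μ] {ε L : ℝ}
    (h : ∀ w, ε ≤ w → w ≤ L → ‖charFun μ w‖ < 1) :
    ∃ ρ : ℝ, 0 < ρ ∧ ρ < 1 ∧ ∀ u w, ε ≤ w → w ≤ L →
      ‖charFun μ u‖ * ‖charFun μ (u + w)‖ ≤ ρ := by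
  rcases lt_or_ge L ε with hL | hL
  · exact ⟨1 / 2, by norm_num, by norm_num, fun u w h1 h2 => by linarith⟩
  obtain ⟨w₀, hw₀, hmax⟩ := isCompact_Icc.exists_isMaxOn (Set.nonempty_Icc.mpr hL)
    (continuous_charFun (μ := μ)).norm.continuousOn
  have hlt := h w₀ hw₀.1 hw₀.2
  set q := ‖charFun μ w₀‖ ^ 2
  have hq0 : 0 ≤ q := by positivity
  have hq1 : q < 1 := by
    have := norm_nonneg (charFun μ w₀)
    simp only [q]
    nlinarith
  -- The previous inequality gives `1 - q ≤ 4 (1 - m)` for the smaller `m` of the two squared norms,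
  -- and `m` bounds their product.
  refine ⟨√(1 - (1 - q) / 4), Real.sqrt_pos.mpr (by linarith), ?_, fun u w h1 h2 => ?_⟩
  · rw [Real.sqrt_lt' one_pos]
    linarith
  · refine Real.le_sqrt_of_sq_le ?_
    have hw : ‖charFun μ w‖ ^ 2 ≤ q :=
      pow_le_pow_left₀ (norm_nonneg _) (hmax ⟨h1, h2⟩) 2
    have key := one_sub_norm_charFun_sq_le μ u w
    have b1 : ‖charFun μ u‖ ^ 2 ≤ 1 := pow_le_one₀ (norm_nonneg _) (norm_charFun_le_one _)
    have b2 : ‖charFun μ (u + w)‖ ^ 2 ≤ 1 := pow_le_one₀ (norm_nonneg _) (norm_charFun_le_one _)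
    have p1 : 0 ≤ ‖charFun μ u‖ ^ 2 := by positivity
    have p2 : 0 ≤ ‖charFun μ (u + w)‖ ^ 2 := by positivity
    rw [mul_pow]
    rcases le_total (‖charFun μ u‖ ^ 2) (‖charFun μ (u + w)‖ ^ 2) with hle | hle <;> nlinarith

lemma norm_charFun_mul_abs (μ : Measure ℝ) {r : ℝ} (t : ℝ) :
    ‖charFun μ (r * |t|)‖ = ‖charFun μ (r * t)‖ := by
  rcases abs_choice t with ht | ht
  · rw [ht]
  · rw [ht, mul_neg, charFun_neg, RCLike.norm_conj]

/-- Away from the origin, the characteristic function of `∑ (j + 1) X_j` decays exponentially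
in the number of summands, uniformly over half a period. -/
lemma exists_prod_norm_charFun_le {μ : Measure ℝ} [IsProbabilityMeasure μ] {L : ℝ} (hL : 0 < L)
    (h : ∀ w, 0 < w → w ≤ L → ‖charFun μ w‖ < 1) {δ : ℝ} (hδ : 0 < δ) :
    ∃ κ : ℝ, 0 < κ ∧ ∀ n : ℕ, 4 ≤ n → ∀ t : ℝ, δ / n ≤ |t| → |t| ≤ L →
      ∏ j ∈ Finset.range n, ‖charFun μ ((j + 1) * t)‖ ≤ Real.exp (-(κ * n)) := by
  set ε := min (δ / 8) (L / 2) with hε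
  have hε0 : 0 < ε := lt_min (by positivity) (by positivity)
  have hε1 : ε ≤ δ / 8 := min_le_left _ _
  have hε2 : ε ≤ L / 2 := min_le_right _ _
  obtain ⟨ρ, hρ0, hρ1, hρ⟩ := exists_norm_charFun_mul_le (μ := μ) (ε := ε) (L := L)
    fun w h1 h2 => h w (by linarith) h2
  refine ⟨-Real.log ρ / 4, by have := Real.log_neg hρ0 hρ1; linarith, fun n hn t ht1 ht2 => ?_⟩
  simp_rw [← norm_charFun_mul_abs μ t]
  have hn' : (4 : ℝ) ≤ n := by exact_mod_cast hn
  set τ := |t|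
  have hτ : 0 < τ := lt_of_lt_of_le (by positivity) ht1
  -- The shift `m τ` must land in `[ε, L]`, where the gap `ρ` is available. If `τ < ε`, rounding up
  -- overshoots by less than `τ`, hence `m τ < 2 ε ≤ L`; the bound `ε ≤ δ / 8` keeps `m` below `n /
  -- 2`.
  obtain ⟨m, hm1, hm2, hm3⟩ : ∃ m : ℕ, ε ≤ m * τ ∧ m * τ ≤ L ∧ (m : ℝ) ≤ n / 2 := by
    rcases le_or_gt ε τ with hle | hlt
    · exact ⟨1, by simpa using hle, by simpa using ht2, by push_cast; linarith⟩
    · have c1 := Nat.le_ceil (ε / τ)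
      have c2 := Nat.ceil_lt_add_one (show 0 ≤ ε / τ by positivity)
      refine ⟨⌈ε / τ⌉₊, (div_le_iff₀ hτ).mp c1, ?_, ?_⟩
      · have : (⌈ε / τ⌉₊ : ℝ) * τ ≤ (ε / τ + 1) * τ := by gcongr
        rw [add_mul, div_mul_cancel₀ _ hτ.ne'] at this
        linarith
      · have : ε / τ ≤ n / 8 := by
          rw [div_le_iff₀ hτ]
          rw [div_le_iff₀ (by positivity)] at ht1
          linarith
        linarith
  have hmn : m ≤ n := by
    have : (m : ℝ) ≤ n := by linarith
    exact_mod_cast this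
  obtain ⟨k, rfl⟩ := Nat.exists_eq_add_of_le hmn
  set f : ℕ → ℝ := fun j => ‖charFun μ ((j + 1) * τ)‖ with hf
  have f0 : ∀ j, 0 ≤ f j := fun j => norm_nonneg _
  have f1 : ∀ j, f j ≤ 1 := fun j => norm_charFun_le_one _
  have hp0 : 0 ≤ ∏ j ∈ Finset.range (m + k), f j := Finset.prod_nonneg fun j _ => f0 j
  have hA : ∏ j ∈ Finset.range (m + k), f j ≤ ∏ j ∈ Finset.range k, f (m + j) := by
    rw [Finset.prod_range_add]
    exact mul_le_of_le_one_left (Finset.prod_nonneg fun j _ => f0 _)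
      (Finset.prod_le_one (fun j _ => f0 _) fun j _ => f1 _)
  have hB : ∏ j ∈ Finset.range (m + k), f j ≤ ∏ j ∈ Finset.range k, f j := by
    rw [add_comm, Finset.prod_range_add]
    exact mul_le_of_le_one_right (Finset.prod_nonneg fun j _ => f0 _)
      (Finset.prod_le_one (fun j _ => f0 _) fun j _ => f1 _)
  -- The product is bounded both by its first `k` and by its last `k` factors; multiplying the
  -- bounds pairs `j` with `m + j`. As `k ≥ n / 2`, this gives the rate `ρ ^ (n / 4)`.
  have hC : (∏ j ∈ Finset.range (m + k), f j) ^ 2 ≤ ρ ^ k := by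
    rw [sq]
    calc _ ≤ (∏ j ∈ Finset.range k, f j) * ∏ j ∈ Finset.range k, f (m + j) :=
          mul_le_mul hB hA hp0 (Finset.prod_nonneg fun j _ => f0 _)
      _ = ∏ j ∈ Finset.range k, f j * f (m + j) := Finset.prod_mul_distrib.symm
      _ ≤ ∏ _j ∈ Finset.range k, ρ := by
          refine Finset.prod_le_prod (fun j _ => mul_nonneg (f0 _) (f0 _)) fun j _ => ?_
          have := hρ ((j + 1) * τ) (m * τ) hm1 hm2
          simp only [hf]
          rwa [show ((m + j : ℕ) + 1 : ℝ) * τ = (j + 1) * τ + m * τ by push_cast; ring]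
      _ = ρ ^ k := by simp
  refine le_of_sq_le_sq ?_ (Real.exp_pos _).le
  refine hC.trans ?_
  rw [← Real.exp_nat_mul, ← Real.exp_log (pow_pos hρ0 k), Real.log_pow, Real.exp_le_exp]
  push_cast at hm3 ⊢
  have := Real.log_neg hρ0 hρ1
  nlinarith

/-! ### Inversion for lattice variables, and stability of the inverse transform. -/

lemma integral_exp_int_mul {h : ℝ} (hh : 0 < h) (k : ℤ) :
    ∫ t in Set.Icc (-(π / h)) (π / h), Complex.exp (h * k * Complex.I * t)
      = if k = 0 then ((2 * π / h : ℝ) : ℂ) else 0 := by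
  have hle : -(π / h) ≤ π / h := by
    have : 0 < π / h := by positivity
    linarith
  rw [integral_Icc_eq_integral_Ioc, ← intervalIntegral.integral_of_le hle]
  split_ifs with hk
  · subst hk
    simp
    ring
  · have hne : (h * k * Complex.I : ℂ) ≠ 0 := by
      simp [hk, hh.ne']
    rw [integral_exp_mul_complex hne]
    have hh' : (h : ℂ) ≠ 0 := by exact_mod_cast hh.ne'
    have e : Complex.exp (h * k * Complex.I * ((π / h : ℝ) : ℂ))
        = Complex.exp (h * k * Complex.I * ((-(π / h) : ℝ) : ℂ)) := by
      rw [Complex.exp_eq_exp_iff_exists_int]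
      refine ⟨k, ?_⟩
      push_cast
      field_simp
      ring
    rw [e, sub_self, zero_div]

/-- The inversion formula for a lattice variable. -/
lemma measureReal_eq_integral_charFun {Ω : Type*} [MeasurableSpace Ω] {P : Measure Ω}
    [IsProbabilityMeasure P] {T : Ω → ℝ} (hT : Measurable T) {y h : ℝ} (hh : 0 < h)
    (hlat : ∀ᵐ ω ∂P, ∃ k : ℤ, T ω = y + h * k) :
    ((2 * π / h * P.real {ω | T ω = y} : ℝ) : ℂ)
      = ∫ t in Set.Icc (-(π / h)) (π / h), Complex.exp (-(t * y * Complex.I)) *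
          charFun (P.map T) t := by
  have h1 : ∀ t : ℝ, Complex.exp (-(t * y * Complex.I)) * charFun (P.map T) t
      = ∫ ω, Complex.exp (((t * (T ω - y) : ℝ) : ℂ) * Complex.I) ∂P := by
    intro t
    rw [charFun_apply_real, integral_map hT.aemeasurable (by fun_prop), ← integral_const_mul]
    congr 1 with ω
    rw [← Complex.exp_add]
    congr 1
    push_cast
    ring
  simp_rw [h1]
  rw [integral_integral_swap]
  · have h2 : ∀ᵐ ω ∂P, ∫ t in Set.Icc (-(π / h)) (π / h),
        Complex.exp (((t * (T ω - y) : ℝ) : ℂ) * Complex.I)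
        = Set.indicator {ω | T ω = y} (fun _ => ((2 * π / h : ℝ) : ℂ)) ω := by
      filter_upwards [hlat] with ω ⟨k, hk⟩
      have h3 := integral_exp_int_mul hh k
      rw [hk]
      have h4 : ∀ t : ℝ, Complex.exp (((t * (y + h * k - y) : ℝ) : ℂ) * Complex.I)
          = Complex.exp (h * k * Complex.I * t) := by
        intro t
        congr 1
        push_cast
        ring
      simp_rw [h4]
      rw [h3, Set.indicator_apply]
      congr 1
      simp [hk, hh.ne']
    have hms : MeasurableSet {ω | T ω = y} := hT (measurableSet_singleton y)
    rw [integral_congr_ae h2, integral_indicator_const _ hms,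
      Complex.real_smul, ← Complex.ofReal_mul, mul_comm]
  · refine (integrable_const (1 : ℝ)).mono' ?_ (ae_of_all _ fun p => ?_)
    · refine Measurable.aestronglyMeasurable ?_
      simp only [Function.uncurry_def]
      fun_prop
    · simp only [Function.uncurry_def]
      rw [Complex.norm_exp_ofReal_mul_I]

/-- The rescaled inversion formula for a lattice variable. -/
lemma mul_measureReal_eq_inverseCharFun {Ω : Type*} [MeasurableSpace Ω] {P : Measure Ω}
    [IsProbabilityMeasure P] {T : Ω → ℝ} (hT : Measurable T) {x h N : ℝ} (hh : 0 < h)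
    (hN : 0 < N) (hlat : ∀ᵐ ω ∂P, ∃ k : ℤ, T ω = N * x + h * k) :
    ((N / h * P.real {ω | T ω = N * x} : ℝ) : ℂ)
      = inverseCharFun (Set.indicator (Set.Icc (-(π / h * N)) (π / h * N))
          fun s => charFun (P.map T) (N⁻¹ * s)) x := by
  have key := measureReal_eq_integral_charFun hT hh hlat
  rw [← integral_indicator measurableSet_Icc] at key
  have hs := Measure.integral_comp_mul_left (fun t : ℝ =>
    Set.indicator (Set.Icc (-(π / h)) (π / h)) (fun t : ℝ =>
      Complex.exp (-(t * ((N * x : ℝ) : ℂ) * Complex.I)) * charFun (P.map T) t) t) N⁻¹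
  rw [← key, inv_inv, abs_of_pos hN, Complex.real_smul] at hs
  rw [inverseCharFun]
  have e : ∀ s : ℝ, Complex.exp (-(s * x * Complex.I)) *
      Set.indicator (Set.Icc (-(π / h * N)) (π / h * N))
        (fun s => charFun (P.map T) (N⁻¹ * s)) s
      = Set.indicator (Set.Icc (-(π / h)) (π / h)) (fun t : ℝ =>
        Complex.exp (-(t * ((N * x : ℝ) : ℂ) * Complex.I)) * charFun (P.map T) t) (N⁻¹ * s) := by
    intro s
    have hmem : s ∈ Set.Icc (-(π / h * N)) (π / h * N) ↔
        N⁻¹ * s ∈ Set.Icc (-(π / h)) (π / h) := by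
      rw [Set.mem_Icc, Set.mem_Icc, ← neg_mul, inv_mul_eq_div, le_div_iff₀ hN, div_le_iff₀ hN]
    by_cases hsm : s ∈ Set.Icc (-(π / h * N)) (π / h * N)
    · rw [Set.indicator_of_mem hsm, Set.indicator_of_mem (hmem.mp hsm)]
      congr 3
      have : (N : ℂ) ≠ 0 := by exact_mod_cast hN.ne'
      push_cast
      field_simp
    · rw [Set.indicator_of_notMem hsm, Set.indicator_of_notMem (mt hmem.mpr hsm), mul_zero]
  simp_rw [e]
  rw [hs]
  have hh' : (h : ℂ) ≠ 0 := by exact_mod_cast hh.ne'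
  have hpi : (π : ℂ) ≠ 0 := by exact_mod_cast Real.pi_ne_zero
  push_cast
  field_simp

lemma norm_inverseCharFun_sub_le {f g : ℝ → ℂ} (hf : Integrable f) (hg : Integrable g) (x : ℝ) :
    ‖inverseCharFun f x - inverseCharFun g x‖ ≤ (2 * π)⁻¹ * ∫ s, ‖f s - g s‖ := by
  have hn : ∀ t : ℝ, ‖Complex.exp (-(t * x * Complex.I))‖ = 1 := by
    intro t
    have := Complex.norm_exp_ofReal_mul_I (-(t * x))
    rwa [Complex.ofReal_neg, Complex.ofReal_mul, neg_mul] at this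
  have hi : ∀ {f : ℝ → ℂ}, Integrable f →
      Integrable fun t : ℝ => Complex.exp (-(t * x * Complex.I)) * f t := fun hf =>
    hf.bdd_mul (c := 1) (by fun_prop) (ae_of_all _ fun t => (hn t).le)
  rw [inverseCharFun, inverseCharFun, ← mul_sub, ← integral_sub (hi hf) (hi hg), norm_mul,
    Complex.norm_real, Real.norm_eq_abs, abs_of_pos (by positivity)]
  gcongr
  refine (norm_integral_le_integral_norm _).trans (le_of_eq ?_)
  congr 1 with t
  rw [← mul_sub, norm_mul, hn, one_mul]

/-- Source of the factor `(α + 1) ^ (1 / α)`, both outside and inside `g`. -/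
lemma inverseCharFun_comp_mul {f : ℝ → ℂ} {r : ℝ} (hr : 0 < r) (x : ℝ) :
    inverseCharFun (fun s => f (r⁻¹ * s)) x = r * inverseCharFun f (r * x) := by
  have hs := Measure.integral_comp_mul_left (fun t : ℝ =>
    Complex.exp (-(t * ((r * x : ℝ) : ℂ) * Complex.I)) * f t) r⁻¹
  rw [inv_inv, abs_of_pos hr, Complex.real_smul] at hs
  rw [inverseCharFun, inverseCharFun, mul_left_comm, ← hs]
  congr 2 with t
  congr 3
  have : (r : ℂ) ≠ 0 := by exact_mod_cast hr.ne'
  push_cast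
  field_simp

/-! ### Power sums and integrable majorants. -/

/-- The normalised power sum `n ^ (-(α + 1)) * (1 ^ α + ⋯ + n ^ α)`. -/
noncomputable def powerMean (α : ℝ) (n : ℕ) : ℝ :=
  (∑ j ∈ Finset.range n, ((j : ℝ) + 1) ^ α) / (n : ℝ) ^ (α + 1)

/-- Comparison with `∫ x ^ α`. The bound holds for every positive `n`, not only in the limit, as the
integrable majorant requires. -/
lemma le_powerMean {α : ℝ} (hα : 0 < α) {n : ℕ} (hn : 0 < n) : 1 / (α + 1) ≤ powerMean α n := by
  have hn' : (0 : ℝ) < n := by exact_mod_cast hn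
  have h := MonotoneOn.integral_le_sum (x₀ := 0) (a := n) (f := fun x : ℝ => x ^ α)
    fun x hx y _ hxy => Real.rpow_le_rpow hx.1 hxy hα.le
  rw [integral_rpow (Or.inl (by linarith)), zero_add, Real.zero_rpow (by positivity),
    sub_zero] at h
  rw [powerMean, le_div_iff₀ (by positivity), one_div_mul_eq_div]
  simpa using h

lemma powerMean_le {α : ℝ} (hα : 0 < α) {n : ℕ} (hn : 0 < n) :
    powerMean α n ≤ 1 / (α + 1) + 1 / n := by
  have hn' : (0 : ℝ) < n := by exact_mod_cast hn
  have h := MonotoneOn.sum_le_integral (x₀ := 0) (a := n) (f := fun x : ℝ => x ^ α)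
    fun x hx y _ hxy => Real.rpow_le_rpow hx.1 hxy hα.le
  rw [integral_rpow (Or.inl (by linarith)), zero_add, Real.zero_rpow (by positivity),
    sub_zero] at h
  have h2 := Finset.sum_range_succ' (fun j : ℕ => (j : ℝ) ^ α) n
  rw [Finset.sum_range_succ] at h2
  simp only [Nat.cast_add, Nat.cast_one, Nat.cast_zero, Real.zero_rpow hα.ne', add_zero] at h2
  simp only [zero_add] at h
  rw [powerMean, div_le_iff₀ (by positivity), ← h2, add_mul, one_div_mul_eq_div,
    Real.rpow_add_one hn'.ne']
  rw [Real.rpow_add_one hn'.ne'] at h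
  have : 1 / (n : ℝ) * (n ^ α * n) = n ^ α := by field_simp
  linarith

lemma tendsto_powerMean {α : ℝ} (hα : 0 < α) :
    Tendsto (powerMean α) atTop (𝓝 (1 / (α + 1))) := by
  have h : Tendsto (fun n : ℕ => 1 / (α + 1) + 1 / (n : ℝ)) atTop (𝓝 (1 / (α + 1) + 0)) :=
    tendsto_one_div_atTop_nhds_zero_nat.const_add _
  rw [add_zero] at h
  refine tendsto_of_tendsto_of_tendsto_of_le_of_le' tendsto_const_nhds h ?_ ?_
  · filter_upwards [eventually_gt_atTop 0] with n hn using le_powerMean hα hn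
  · filter_upwards [eventually_gt_atTop 0] with n hn using powerMean_le hα hn

lemma sum_abs_mul_rpow {α : ℝ} (hα : 0 < α) {n : ℕ} (hn : 0 < n) (s : ℝ) :
    ∑ j ∈ Finset.range n, |((j : ℝ) + 1) * (((n : ℝ) ^ (1 + 1 / α))⁻¹ * s)| ^ α
      = |s| ^ α * powerMean α n := by
  have hn' : (0 : ℝ) < n := by exact_mod_cast hn
  have e : ((n : ℝ) ^ (1 + 1 / α)) ^ α = (n : ℝ) ^ (α + 1) := by
    rw [← Real.rpow_mul hn'.le]
    congr 1
    field_simp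
  rw [powerMean, mul_div_assoc', Finset.mul_sum, Finset.sum_div]
  refine Finset.sum_congr rfl fun j _ => ?_
  rw [abs_mul, abs_mul, abs_inv, abs_of_pos (show (0 : ℝ) < (j : ℝ) + 1 by positivity),
    abs_of_pos (show (0 : ℝ) < (n : ℝ) ^ (1 + 1 / α) by positivity),
    Real.mul_rpow (by positivity) (by positivity), Real.mul_rpow (by positivity) (by positivity),
    Real.inv_rpow (by positivity), e]
  field_simp

lemma abs_mul_inv_rpow_le {α : ℝ} {n : ℕ} {s δ : ℝ}
    (hs : |s| ≤ δ * (n : ℝ) ^ (1 / α)) {j : ℕ} (hj : j ∈ Finset.range n) :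
    |((j : ℝ) + 1) * (((n : ℝ) ^ (1 + 1 / α))⁻¹ * s)| ≤ δ := by
  have hjn : (j : ℝ) + 1 ≤ n := by exact_mod_cast Finset.mem_range.mp hj
  have hn' : (0 : ℝ) < n := lt_of_lt_of_le (by positivity) hjn
  rw [abs_mul, abs_mul, abs_inv, abs_of_pos (show (0 : ℝ) < (j : ℝ) + 1 by positivity),
    abs_of_pos (show (0 : ℝ) < (n : ℝ) ^ (1 + 1 / α) by positivity)]
  calc ((j : ℝ) + 1) * (((n : ℝ) ^ (1 + 1 / α))⁻¹ * |s|)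
      ≤ n * (((n : ℝ) ^ (1 + 1 / α))⁻¹ * (δ * (n : ℝ) ^ (1 / α))) := by gcongr
    _ = δ := by
      rw [Real.rpow_add hn', Real.rpow_one]
      have : 0 < (n : ℝ) ^ (1 / α) := by positivity
      field_simp

lemma integrable_exp_neg_mul_abs_rpow {k p : ℝ} (hk : 0 < k) (hp : 0 < p) :
    Integrable fun s : ℝ => Real.exp (-(k * |s| ^ p)) := by
  have h := integrableOn_rpow_mul_exp_neg_mul_rpow (s := 0) (by norm_num) hp hk
  simp only [Real.rpow_zero, one_mul, neg_mul] at h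
  simpa using (integrable_fun_norm_addHaar (volume : Measure ℝ)
    (f := fun s : ℝ => Real.exp (-(k * s ^ p)))).mpr (by simpa using h)

/-! ### Convergence in `L¹` of the rescaled characteristic functions. -/

section CharFun

variable {μ : Measure ℝ} [IsProbabilityMeasure μ] {α C : ℝ}

lemma exists_forall_abs_log_charFun_add_le
    (hlog : Tendsto (fun s : ℝ => Real.log ‖charFun μ s‖ / s ^ α) (𝓝[>] 0) (𝓝 (-C)))
    (hα : 0 < α) {ε : ℝ} (hε : 0 < ε) :
    ∃ δ > 0, ∀ s, |s| ≤ δ →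
      0 < ‖charFun μ s‖ ∧ |Real.log ‖charFun μ s‖ + C * |s| ^ α| ≤ ε * |s| ^ α := by
  have hpos : ∀ᶠ s in 𝓝[>] (0 : ℝ), 0 < ‖charFun μ s‖ := by
    have h : Tendsto (fun s => ‖charFun μ s‖) (𝓝 0) (𝓝 ‖charFun μ 0‖) :=
      continuous_charFun.norm.tendsto 0
    exact (h.eventually_const_lt (by simp)).filter_mono nhdsWithin_le_nhds
  have hclose := Metric.tendsto_nhds.mp hlog ε hε
  obtain ⟨δ, hδ, hmem⟩ := mem_nhdsGT_iff_exists_Ioc_subset.mp (hpos.and hclose)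
  refine ⟨δ, hδ, fun s hs => ?_⟩
  have habs : ‖charFun μ s‖ = ‖charFun μ |s|‖ := by
    simpa using (norm_charFun_mul_abs μ (r := 1) s).symm
  rcases eq_or_ne s 0 with rfl | hs0
  · simp [hα.ne']
  · have hs' : 0 < |s| := abs_pos.mpr hs0
    obtain ⟨h1, h2⟩ := hmem ⟨hs', hs⟩
    rw [habs]
    refine ⟨h1, ?_⟩
    have hp : 0 < |s| ^ α := by positivity
    rw [Real.dist_eq, sub_neg_eq_add, div_add' _ _ _ hp.ne', abs_div, abs_of_pos hp,
      div_lt_iff₀ hp] at h2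
    exact h2.le

lemma exists_forall_charFun_eq_norm (hre : ∀ t, ((charFun μ t).re : ℂ) = charFun μ t) :
    ∃ δ > 0, ∀ s, |s| ≤ δ → charFun μ s = (‖charFun μ s‖ : ℝ) := by
  have h : Tendsto (fun s => (charFun μ s).re) (𝓝 0) (𝓝 (charFun μ 0).re) :=
    (Complex.continuous_re.comp continuous_charFun).tendsto 0
  obtain ⟨δ, hδ, hball⟩ := Metric.nhds_basis_closedBall.mem_iff.mp
    (h.eventually_const_lt (show 0 < (charFun μ 0).re by simp))
  refine ⟨δ, hδ, fun s hs => ?_⟩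
  have hs' : 0 < (charFun μ s).re := hball (by simpa using hs)
  rw [← hre s, Complex.norm_real, Real.norm_eq_abs, abs_of_pos hs']

lemma tendsto_prod_charFun
    (hlog : Tendsto (fun s : ℝ => Real.log ‖charFun μ s‖ / s ^ α) (𝓝[>] 0) (𝓝 (-C)))
    (hα : 0 < α) (hre : ∀ t, ((charFun μ t).re : ℂ) = charFun μ t) (s : ℝ) :
    Tendsto (fun n : ℕ => ∏ j ∈ Finset.range n,
      charFun μ ((j + 1) * (((n : ℝ) ^ (1 + 1 / α))⁻¹ * s))) atTop
      (𝓝 (Real.exp (-(C / (α + 1) * |s| ^ α)) : ℝ)) := by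
  have hsmall : ∀ δ > 0, ∀ᶠ n : ℕ in atTop, |s| ≤ δ * (n : ℝ) ^ (1 / α) := fun δ hδ =>
    (((tendsto_rpow_atTop (one_div_pos.mpr hα)).comp
      tendsto_natCast_atTop_atTop).const_mul_atTop hδ).eventually_ge_atTop _
  set u : ℕ → ℕ → ℝ := fun n j => ((j : ℝ) + 1) * (((n : ℝ) ^ (1 + 1 / α))⁻¹ * s) with hu
  set S : ℕ → ℝ := fun n => ∑ j ∈ Finset.range n, Real.log ‖charFun μ (u n j)‖ with hS
  have hdiff : Tendsto (fun n => S n + C * (|s| ^ α * powerMean α n)) atTop (𝓝 0) := by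
    refine Metric.tendsto_nhds.mpr fun ε hε => ?_
    -- The factor `2` bounds `powerMean α n` for `n ≥ 1`, and the `+ 1` covers `s = 0`.
    set η := ε / (2 * (|s| ^ α + 1)) with hη
    have hsα : 0 ≤ |s| ^ α := by positivity
    have hη0 : 0 < η := by positivity
    obtain ⟨δ, hδ, hnear⟩ := exists_forall_abs_log_charFun_add_le hlog hα hη0
    filter_upwards [hsmall δ hδ, eventually_ge_atTop 1] with n hn hn1
    have hle : powerMean α n ≤ 2 := by
      refine (powerMean_le hα hn1).trans ?_
      have h1 : 1 / (α + 1) ≤ 1 := by rw [div_le_one (by positivity)]; linarith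
      have h2 : 1 / (n : ℝ) ≤ 1 := by
        rw [div_le_one (by positivity)]; exact_mod_cast hn1
      linarith
    rw [dist_zero_right, Real.norm_eq_abs, ← sum_abs_mul_rpow hα hn1, Finset.mul_sum, hS]
    simp only
    rw [← Finset.sum_add_distrib]
    calc |∑ j ∈ Finset.range n, (Real.log ‖charFun μ (u n j)‖ + C * |u n j| ^ α)|
        ≤ ∑ j ∈ Finset.range n, η * |u n j| ^ α :=
          (Finset.abs_sum_le_sum_abs _ _).trans (Finset.sum_le_sum fun j hj =>
            (hnear _ (abs_mul_inv_rpow_le hn hj)).2)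
      _ = η * (|s| ^ α * powerMean α n) := by
          rw [← Finset.mul_sum, ← sum_abs_mul_rpow hα hn1]
      _ ≤ η * (|s| ^ α * 2) := by gcongr
      _ < ε := by
          rw [hη, div_mul_eq_mul_div, div_lt_iff₀ (by positivity)]
          nlinarith
  have hlim : Tendsto S atTop (𝓝 (-(C / (α + 1) * |s| ^ α))) := by
    have h := hdiff.sub (((tendsto_powerMean hα).const_mul (|s| ^ α)).const_mul C)
    simp only [add_sub_cancel_right] at h
    convert h using 2
    ring
  have hexp := (Complex.continuous_ofReal.tendsto _).comp
    ((Real.continuous_exp.tendsto _).comp hlim)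
  refine hexp.congr' ?_
  obtain ⟨δ, hδ, hnear⟩ := exists_forall_abs_log_charFun_add_le hlog hα one_pos
  obtain ⟨δ', hδ', hnorm⟩ := exists_forall_charFun_eq_norm hre
  filter_upwards [hsmall δ hδ, hsmall δ' hδ'] with n hn hn'
  simp only [Function.comp_apply, hS]
  rw [Real.exp_sum, Complex.ofReal_prod]
  refine Finset.prod_congr rfl fun j hj => ?_
  rw [Real.exp_log (hnear _ (abs_mul_inv_rpow_le hn hj)).1,
    ← hnorm _ (abs_mul_inv_rpow_le hn' hj)]

/-- The integrable majorant of the rescaled characteristic functions. -/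
lemma exists_norm_prod_charFun_le
    (hlog : Tendsto (fun s : ℝ => Real.log ‖charFun μ s‖ / s ^ α) (𝓝[>] 0) (𝓝 (-C)))
    (hα : 0 < α) (hC : 0 < C) {L : ℝ} (hL : 0 < L)
    (h : ∀ w, 0 < w → w ≤ L → ‖charFun μ w‖ < 1) :
    ∃ κ : ℝ, 0 < κ ∧ ∀ n : ℕ, 4 ≤ n → ∀ s : ℝ, |s| ≤ L * (n : ℝ) ^ (1 + 1 / α) →
      ‖∏ j ∈ Finset.range n, charFun μ ((j + 1) * (((n : ℝ) ^ (1 + 1 / α))⁻¹ * s))‖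
        ≤ Real.exp (-(C / (2 * (α + 1)) * |s| ^ α))
          + Real.exp (-(κ * |s| ^ (α / (α + 1)))) := by
  obtain ⟨δ, hδ, hnear⟩ := exists_forall_abs_log_charFun_add_le hlog hα (half_pos hC)
  obtain ⟨κ, hκ, hfar⟩ := exists_prod_norm_charFun_le hL h hδ
  refine ⟨κ * L⁻¹ ^ (α / (α + 1)), by positivity, fun n hn s hs => ?_⟩
  have hn0 : 0 < n := by omega
  have hn' : (0 : ℝ) < n := by exact_mod_cast hn0
  have hN : 0 < (n : ℝ) ^ (1 + 1 / α) := by positivity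
  have habs : |((n : ℝ) ^ (1 + 1 / α))⁻¹ * s| = |s| / (n : ℝ) ^ (1 + 1 / α) := by
    rw [abs_mul, abs_inv, abs_of_pos hN, inv_mul_eq_div]
  have hsplit : (n : ℝ) ^ (1 + 1 / α) = n * (n : ℝ) ^ (1 / α) := by
    rw [Real.rpow_add hn', Real.rpow_one]
  rw [norm_prod]
  rcases le_or_gt |s| (δ * (n : ℝ) ^ (1 / α)) with hle | hgt
  · refine le_add_of_le_of_nonneg ?_ (Real.exp_pos _).le
    calc ∏ j ∈ Finset.range n, ‖charFun μ ((j + 1) * (((n : ℝ) ^ (1 + 1 / α))⁻¹ * s))‖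
        ≤ ∏ j ∈ Finset.range n,
            Real.exp (-(C / 2) * |((j : ℝ) + 1) * (((n : ℝ) ^ (1 + 1 / α))⁻¹ * s)| ^ α) := by
          refine Finset.prod_le_prod (fun j _ => norm_nonneg _) fun j hj => ?_
          obtain ⟨h1, h2⟩ := hnear _ (abs_mul_inv_rpow_le hle hj)
          rw [← Real.log_le_iff_le_exp h1]
          have := (abs_le.mp h2).2
          linarith
      _ = Real.exp (-(C / 2) * (|s| ^ α * powerMean α n)) := by
          rw [← Real.exp_sum, ← Finset.mul_sum, sum_abs_mul_rpow hα hn0]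
      _ ≤ Real.exp (-(C / (2 * (α + 1)) * |s| ^ α)) := by
          rw [Real.exp_le_exp, neg_mul, neg_le_neg_iff]
          calc C / (2 * (α + 1)) * |s| ^ α = C / 2 * (|s| ^ α * (1 / (α + 1))) := by
                field_simp
            _ ≤ _ := by
                gcongr
                exact le_powerMean hα hn0
  -- Here the decay is `exp (-κ n)`. The cutoff `|s| ≤ L n ^ (1 + 1 / α)` gives `n ≥ (|s| / L) ^ (α
  -- / (α + 1))`, which makes the bound independent of `n` and integrable in `s`.
  · refine le_add_of_nonneg_of_le (Real.exp_pos _).le ?_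
    refine (hfar n hn _ ?_ ?_).trans ?_
    · rw [habs, hsplit, div_le_div_iff₀ hn' (by positivity)]
      nlinarith
    · rw [habs, div_le_iff₀ hN]
      exact hs
    · rw [Real.exp_le_exp, neg_le_neg_iff, mul_assoc]
      gcongr
      rw [← Real.mul_rpow (by positivity) (by positivity)]
      calc (L⁻¹ * |s|) ^ (α / (α + 1)) ≤ ((n : ℝ) ^ (1 + 1 / α)) ^ (α / (α + 1)) := by
            gcongr
            rw [inv_mul_eq_div, div_le_iff₀ hL, mul_comm]
            exact hs
        _ = n := by
            rw [← Real.rpow_mul hn'.le]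
            conv_rhs => rw [← Real.rpow_one (n : ℝ)]
            congr 1
            field_simp

/-- The rescaled, truncated characteristic function of `∑ (j + 1) X_j`. -/
noncomputable def rescaledProd (μ : Measure ℝ) (α L : ℝ) (n : ℕ) : ℝ → ℂ :=
  Set.indicator (Set.Icc (-(L * (n : ℝ) ^ (1 + 1 / α))) (L * (n : ℝ) ^ (1 + 1 / α)))
    fun s => ∏ j ∈ Finset.range n, charFun μ ((j + 1) * (((n : ℝ) ^ (1 + 1 / α))⁻¹ * s))

lemma integrable_rescaledProd (L : ℝ) (n : ℕ) : Integrable (rescaledProd μ α L n) := by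
  have hc := continuous_charFun (μ := μ)
  rw [rescaledProd, integrable_indicator_iff measurableSet_Icc]
  refine Continuous.integrableOn_Icc ?_
  fun_prop

lemma tendsto_integral_norm_rescaledProd_sub
    (hlog : Tendsto (fun s : ℝ => Real.log ‖charFun μ s‖ / s ^ α) (𝓝[>] 0) (𝓝 (-C)))
    (hα : 0 < α) (hC : 0 < C) (hre : ∀ t, ((charFun μ t).re : ℂ) = charFun μ t)
    {L : ℝ} (hL : 0 < L) (h : ∀ w, 0 < w → w ≤ L → ‖charFun μ w‖ < 1) :
    Tendsto (fun n : ℕ => ∫ s, ‖rescaledProd μ α L n s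
      - (Real.exp (-(C / (α + 1) * |s| ^ α)) : ℝ)‖) atTop (𝓝 0) := by
  obtain ⟨κ, hκ, hdom⟩ := exists_norm_prod_charFun_le hlog hα hC hL h
  have hmeas : Measurable fun s : ℝ => ((Real.exp (-(C / (α + 1) * |s| ^ α)) : ℝ) : ℂ) := by
    fun_prop
  rw [← integral_zero ℝ ℝ (μ := volume)]
  refine tendsto_integral_filter_of_dominated_convergence
    (fun s => Real.exp (-(C / (2 * (α + 1)) * |s| ^ α)) + Real.exp (-(κ * |s| ^ (α / (α + 1))))
      + Real.exp (-(C / (α + 1) * |s| ^ α))) ?_ ?_ ?_ ?_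
  · refine Eventually.of_forall fun n => ?_
    exact ((integrable_rescaledProd L n).aestronglyMeasurable.sub
      hmeas.aestronglyMeasurable).norm
  · filter_upwards [eventually_ge_atTop 4] with n hn
    refine ae_of_all _ fun s => ?_
    rw [norm_norm]
    refine (norm_sub_le _ _).trans (add_le_add ?_ ?_)
    · rw [rescaledProd]
      by_cases hs : s ∈ Set.Icc (-(L * (n : ℝ) ^ (1 + 1 / α))) (L * (n : ℝ) ^ (1 + 1 / α))
      · rw [Set.indicator_of_mem hs]
        exact hdom n hn s (abs_le.mpr hs)
      · rw [Set.indicator_of_notMem hs, norm_zero]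
        positivity
    · rw [Complex.norm_real, Real.norm_eq_abs, abs_of_pos (Real.exp_pos _)]
  · exact ((integrable_exp_neg_mul_abs_rpow (by positivity) hα).add
      (integrable_exp_neg_mul_abs_rpow hκ (by positivity))).add
      (integrable_exp_neg_mul_abs_rpow (by positivity) hα)
  · refine ae_of_all _ fun s => ?_
    have h1 := ((tendsto_prod_charFun hlog hα hre s).sub_const
      ((Real.exp (-(C / (α + 1) * |s| ^ α)) : ℝ) : ℂ)).norm
    rw [sub_self, norm_zero] at h1
    refine h1.congr' ?_
    have hbig : ∀ᶠ n : ℕ in atTop, |s| ≤ L * (n : ℝ) ^ (1 + 1 / α) :=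
      (((tendsto_rpow_atTop (by positivity)).comp
        tendsto_natCast_atTop_atTop).const_mul_atTop hL).eventually_ge_atTop _
    filter_upwards [hbig] with n hn
    rw [rescaledProd, Set.indicator_of_mem (Set.mem_Icc.mpr (abs_le.mp hn))]

end CharFun

/-! ### The centre of mass as a weighted sum of the increments. -/

variable {Ω : Type*} {X : ℕ → Ω → ℝ}

lemma sum_walk_eq (X : ℕ → Ω → ℝ) (n : ℕ) (ω : Ω) :
    ∑ i ∈ Finset.Icc 1 n, walk X i ω = ∑ i ∈ Finset.range n, ((n : ℝ) - i) * X i ω := by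
  induction n with
  | zero => simp
  | succ n ih =>
    rw [Finset.sum_Icc_succ_top (by omega), ih, walk, Finset.sum_range_succ, Finset.sum_range_succ,
      ← add_assoc, ← Finset.sum_add_distrib]
    congr 1
    · refine Finset.sum_congr rfl fun i _ => ?_
      push_cast
      ring
    · push_cast
      ring

lemma exists_walk_eq {b h : ℝ} {ω : Ω} (hω : ∀ i, ∃ k : ℤ, X i ω = b + h * k) (n : ℕ) :
    ∃ k : ℤ, walk X n ω = n * b + h * k := by
  choose k hk using hω
  refine ⟨∑ i ∈ Finset.range n, k i, ?_⟩
  simp [walk, hk, Finset.sum_add_distrib, Finset.mul_sum]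

lemma exists_sum_walk_eq {b h : ℝ} {ω : Ω} (hω : ∀ i, ∃ k : ℤ, X i ω = b + h * k) (n : ℕ) :
    ∃ k : ℤ, ∑ i ∈ Finset.Icc 1 n, walk X i ω = (n : ℝ) * (n + 1) / 2 * b + h * k := by
  induction n with
  | zero => exact ⟨0, by simp⟩
  | succ n ih =>
    obtain ⟨k, hk⟩ := ih
    obtain ⟨l, hl⟩ := exists_walk_eq hω (n + 1)
    refine ⟨k + l, ?_⟩
    rw [Finset.sum_Icc_succ_top (by omega), hk, hl]
    push_cast
    ring

variable [MeasurableSpace Ω] {P : Measure Ω}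

lemma ae_forall_mem_lattice (hident : ∀ i, IdentDistrib (X i) (X 0) P P) {b h : ℝ}
    (hlat : ∀ᵐ ω ∂P, ∃ k : ℤ, X 0 ω = b + h * k) :
    ∀ᵐ ω ∂P, ∀ i, ∃ k : ℤ, X i ω = b + h * k := by
  have hset : MeasurableSet {x : ℝ | ∃ k : ℤ, x = b + h * k} := by
    have : {x : ℝ | ∃ k : ℤ, x = b + h * k} = Set.range fun k : ℤ => b + h * k := by
      ext x
      simp [eq_comm]
    rw [this]
    exact (Set.countable_range _).measurableSet
  rw [ae_all_iff]
  exact fun i => (hident i).symm.ae_snd hset hlat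

lemma charFun_map_sum_walk (hX : ∀ i, Measurable (X i)) (hindep : iIndepFun X P)
    (hident : ∀ i, IdentDistrib (X i) (X 0) P P) (n : ℕ) (t : ℝ) :
    charFun (P.map fun ω => ∑ i ∈ Finset.Icc 1 n, walk X i ω) t
      = ∏ j ∈ Finset.range n, charFun (P.map (X 0)) ((j + 1) * t) := by
  simp_rw [sum_walk_eq]
  -- The weights `n - i` are reversed to `j + 1`.
  rw [charFun_map_weighted_sum hX hindep hident, ← Finset.prod_range_reflect]
  refine Finset.prod_congr rfl fun j hj => ?_
  have hj' := Finset.mem_range.mp hj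
  congr 2
  rw [Nat.sub_sub, Nat.cast_sub (by omega)]
  push_cast
  ring

lemma mul_pointProb_eq [IsProbabilityMeasure P] (hX : ∀ i, Measurable (X i))
    (hindep : iIndepFun X P) (hident : ∀ i, IdentDistrib (X i) (X 0) P P) {b h : ℝ} (hh : 0 < h)
    (hlat : ∀ᵐ ω ∂P, ∃ k : ℤ, X 0 ω = b + h * k) {α : ℝ} {n : ℕ} (hn : 0 < n) {x : ℝ}
    (hx : x ∈ lattice α b h n) :
    (((n : ℝ) ^ (1 + 1 / α) / h * pointProb P X α n x : ℝ) : ℂ)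
      = inverseCharFun (rescaledProd (P.map (X 0)) α (π / h) n) x := by
  have hn' : (0 : ℝ) < n := by exact_mod_cast hn
  set N : ℝ := (n : ℝ) ^ (1 + 1 / α) with hN
  have hN0 : 0 < N := by positivity
  set T : Ω → ℝ := fun ω => ∑ i ∈ Finset.Icc 1 n, walk X i ω with hT
  have hTm : Measurable T := Finset.measurable_sum _ fun i _ => measurable_walk hX i
  obtain ⟨k₀, hk₀⟩ := hx
  have hNx : N * x = (n : ℝ) * (n + 1) / 2 * b + h * k₀ := by
    rw [hk₀, ← mul_assoc, hN, ← Real.rpow_add hn']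
    ring_nf
    simp
  have hTlat : ∀ᵐ ω ∂P, ∃ k : ℤ, T ω = N * x + h * k := by
    filter_upwards [ae_forall_mem_lattice hident hlat] with ω hω
    obtain ⟨k, hk⟩ := exists_sum_walk_eq hω n
    refine ⟨k - k₀, ?_⟩
    rw [hNx]
    simp only [hT, hk]
    push_cast
    ring
  have hprob : pointProb P X α n x = P.real {ω | T ω = N * x} := by
    rw [pointProb]
    congr 1
    ext ω
    rw [Set.mem_ofPred_eq, Set.mem_ofPred_eq, centre, div_eq_iff hn'.ne', hN, Real.rpow_add hn',
      Real.rpow_one]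
    constructor <;> intro e <;> simp only [hT] at * <;> rw [e] <;> ring
  rw [hprob, mul_measureReal_eq_inverseCharFun hTm hh hN0 hTlat]
  simp_rw [hT, charFun_map_sum_walk hX hindep hident]
  rfl

end CentreOfMass

/-! ### The local limit theorem. -/

open CentreOfMass in
theorem theorem4p5 {Ω : Type*} [MeasurableSpace Ω] (P : Measure Ω) [IsProbabilityMeasure P]
    (X : ℕ → Ω → ℝ) (hX : ∀ i, Measurable (X i))
    (hindep : iIndepFun X P) (hident : ∀ i, IdentDistrib (X i) (X 0) P P)
    (b h : ℝ) (hspan : CentreOfMass.HasMaximalSpan P (X 0) b h)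
    (hsymm : IdentDistrib (X 0) (fun ω => -X 0 ω) P P)
    (α : ℝ) (hα0 : 0 < α) (hα1 : α < 1)
    (ν : Measure ℝ) [IsProbabilityMeasure ν] (hν : CentreOfMass.IsSymmetricStable α ν)
    (a : ℝ) (ha : 0 < a) (hattr : CentreOfMass.NormallyAttracted P X α a ν) :
    -- `g` is the continuous density of the law of `a Z`, where `Z` has law `ν`
    ∃ g : ℝ → ℝ, Continuous g ∧ (∀ x, 0 ≤ g x) ∧
      ν.map (fun z => a * z) = volume.withDensity (fun x => ENNReal.ofReal (g x)) ∧
      Tendsto (fun n : ℕ => ⨆ x ∈ CentreOfMass.lattice α b h n,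
        ENNReal.ofReal |(n : ℝ) ^ (1 + 1 / α) / h * CentreOfMass.pointProb P X α n x
          - (α + 1) ^ (1 / α) * g ((α + 1) ^ (1 / α) * x)|) atTop (𝓝 0) := by
  obtain ⟨c, hc, hνc⟩ := hν.exists_charFun_eq hα0
  set μ := P.map (X 0) with hμ
  have : IsProbabilityMeasure μ := Measure.isProbabilityMeasure_map (hX 0).aemeasurable
  have : IsProbabilityMeasure (ν.map fun z => a * z) :=
    Measure.isProbabilityMeasure_map (by fun_prop)
  have hh := hspan.pos
  set C := c * a ^ α with hC
  have hC0 : 0 < C := by positivity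
  have hre : ∀ t, ((charFun μ t).re : ℂ) = charFun μ t := by
    refine ofReal_re_charFun_of_symm ?_
    rw [hμ, Measure.map_map measurable_neg (hX 0)]
    exact hsymm.map_eq.symm
  -- The inversion integral stops at half a period, strictly before `2π / h`, where the norm returns
  -- to `1`.
  have hlt : ∀ w, 0 < w → w ≤ Real.pi / h → ‖charFun μ w‖ < 1 := fun w hw0 hw =>
    norm_charFun_lt_one_of_maximal_span (hX 0) hspan hw0 (hw.trans_lt (by
      have := Real.pi_pos
      gcongr
      linarith))
  have hlog := tendsto_log_charFun_div_rpow hX hindep hident hα0 hνc ha hattr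
  have hchar : charFun (ν.map fun z => a * z) = fun t => ((Real.exp (-(C * |t| ^ α)) : ℝ) : ℂ) := by
    ext t
    rw [charFun_map_mul, hνc, abs_mul, abs_of_pos ha, Real.mul_rpow ha.le (abs_nonneg t), hC,
      mul_assoc]
  have hint : Integrable (charFun (ν.map fun z => a * z)) := by
    rw [hchar]
    exact (integrable_exp_neg_mul_abs_rpow hC0 hα0).ofReal
  refine ⟨fun x => (inverseCharFun (charFun (ν.map fun z => a * z)) x).re,
    Complex.continuous_re.comp (continuous_inverseCharFun hint),
    inverseCharFun_re_nonneg hint, eq_withDensity_of_integrable_charFun hint, ?_⟩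
  set r : ℝ := (α + 1) ^ (1 / α) with hr
  have hr0 : 0 < r := by positivity
  set Φ : ℝ → ℂ := fun s => ((Real.exp (-(C / (α + 1) * |s| ^ α)) : ℝ) : ℂ) with hΦ
  have hΦint : Integrable Φ := (integrable_exp_neg_mul_abs_rpow (by positivity) hα0).ofReal
  -- Since `r ^ α = α + 1`, dilating by `r` turns `exp (-C |s|^α)` into `Φ`.
  have hlimit : ∀ x, ((r * (inverseCharFun (charFun (ν.map fun z => a * z)) (r * x)).re : ℝ) : ℂ)
      = inverseCharFun Φ x := by
    intro x
    rw [Complex.ofReal_mul, ofReal_re_inverseCharFun, ← inverseCharFun_comp_mul hr0, hchar, hΦ]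
    congr 1 with s
    beta_reduce
    congr 3
    rw [abs_mul, abs_inv, abs_of_pos hr0, Real.mul_rpow (by positivity) (abs_nonneg s),
      Real.inv_rpow hr0.le, hr, ← Real.rpow_mul (by positivity), one_div_mul_cancel hα0.ne',
      Real.rpow_one]
    ring
  have hconv := ((tendsto_integral_norm_rescaledProd_sub hlog hα0 hC0 hre
    (show 0 < Real.pi / h by positivity) hlt).const_mul (2 * Real.pi)⁻¹)
  rw [mul_zero] at hconv
  have hconv' := ENNReal.tendsto_ofReal hconv
  rw [ENNReal.ofReal_zero] at hconv'
  refine tendsto_of_tendsto_of_tendsto_of_le_of_le' tendsto_const_nhds hconv'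
    (Eventually.of_forall fun _ => zero_le) ?_
  filter_upwards [eventually_gt_atTop 0] with n hn
  refine iSup₂_le fun x hx => ENNReal.ofReal_le_ofReal ?_
  rw [← Real.norm_eq_abs, ← Complex.norm_real, Complex.ofReal_sub, hlimit,
    mul_pointProb_eq hX hindep hident hh hspan.mem_lattice hn hx]
  exact norm_inverseCharFun_sub_le (integrable_rescaledProd _ _) hΦint x
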